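/- Let $G$ be a (finite-dimensional, real, smooth) Lie group with $\mathfrak g=T_eG$, and let $\Omega^0(G,\mathfrak g)$ be the space of smooth maps $G\to\mathfrak g$. Let $[\cdot,\cdot]_{\mathfrak g}$ be the Lie bracket on $\mathfrak g$ obtained by identifying $\mathfrak g$ with the *right*-invariant vector fields on $G$ and their Jacobi--Lie bracket $[\![X,Y]\!]\phi=X(Y\phi)-Y(X\phi)$; it is the negative of the bracket obtained from left-invariant vector fields. For $x,y\in\Omega^0(G,\mathfrak g)$ put $[x,y](g)=[x(g),y(g)]_{\mathfrak g}$. Let $\rho_*(x)$ and $\lambda_*(x)$ be the vector fields $$\rho_*(x)(g)=\tfrac{\partial}{\partial t}\big|_{t=0}\,g\exp(t\,x(g))=T_eL_g\,x(g),\qquad \lambda_*(x)(g)=\tfrac{\partial}{\partial t}\big|_{t=0}\exp(t\,x(g))\,g=T_eR_g\,x(g);$$ thus $\rho_*$ is the inverse of the left Maurer--Cartan form $\omega_g=TL_{g^{-1}}$, and $\lambda_*$ is the inverse of the right one. Define $x\mathbin{\tilde\rhd}y:=\rho_*(x)(y)$ and $x\rhd y:=\lambda_*(x)(y)$ (Lie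 derivatives of the $\mathfrak g$-valued function $y$ along these vector fields). A post-Lie algebra $\{A,[\cdot,\cdot],\rhd\}$ is a Lie algebra $\{A,[\cdot,\cdot]\}$ with a bilinear product $\rhd$ on $A$ such that $x\rhd[y,z]=[x\rhd y,z]+[y,x\rhd z]$ and $[x,y]\rhd z=a(x,y,z)-a(y,x,z)$, where $a(x,y,z)=x\rhd(y\rhd z)-(x\rhd y)\rhd z$. Then: 1. $\{\Omega^0(G,\mathfrak g),-[\cdot,\cdot],\tilde\rhd\}$ is a post-Lie algebra over $\mathbb R$. 2. The connection $\tilde\rhd$ of the left trivialization is related to the connection $\rhd$ of the right trivialization by $x\mathbin{\tilde\rhd}y=x\rhd y+[x,y]$, where $\rhd$ is transported to the left trivialization. That is, let $\Phi\colon\Omega^0(G,\mathfrak g)\to\Omega^0(G,\mathfrak g)$, $\Phi(\tilde x)=\omega(\lambda_*(\tilde x))$, be the bijection that sends the right-trivialized representative $\tilde x$ of a vector field to its left-trivialized representative, so that $\rho_*(\Phi(\tilde x))=\lambda_*(\tilde x)$. Then for all $x,y\in\Omega^0(G,\mathfrak g)$, $$x\mathbin{\tilde\rhd}y=\Phi\bigl(\Phi^{-1}(x)\rhd\Phi^{-1}(y)\bigr)+[x,y].$$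 -/

import Mathlib

open scoped Manifold ContDiff

/-- A post-Lie algebra `{A, [·,·], ▷}` over a field `k`: a Lie bracket `br` on `A` together with
a bilinear product `tr` such that `x ▷ ·` is a derivation of the bracket and
`[x,y] ▷ z = a(x,y,z) - a(y,x,z)`, where `a(x,y,z) = x ▷ (y ▷ z) - (x ▷ y) ▷ z`. -/
structure IsPostLieAlgebra (k : Type*) [Field k] {A : Type*} [AddCommGroup A] [Module k A]
    (br tr : A → A → A) : Prop where
  br_add_left : ∀ x y z, br (x + y) z = br x z + br y z
  br_smul_left : ∀ (c : k) x y, br (c • x) y = c • br x y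
  br_add_right : ∀ x y z, br x (y + z) = br x y + br x z
  br_smul_right : ∀ (c : k) x y, br x (c • y) = c • br x y
  br_self : ∀ x, br x x = 0
  br_jacobi : ∀ x y z, br (br x y) z + br (br y z) x + br (br z x) y = 0
  tr_add_left : ∀ x y z, tr (x + y) z = tr x z + tr y z
  tr_smul_left : ∀ (c : k) x y, tr (c • x) y = c • tr x y
  tr_add_right : ∀ x y z, tr x (y + z) = tr x y + tr x z
  tr_smul_right : ∀ (c : k) x y, tr x (c • y) = c • tr x y
  tr_br : ∀ x y z, tr x (br y z) = br (tr x y) z + br y (tr x z)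
  br_tr : ∀ x y z, tr (br x y) z =
    (tr x (tr y z) - tr (tr x y) z) - (tr y (tr x z) - tr (tr y x) z)

namespace LieFun

noncomputable section

variable {E : Type*} [NormedAddCommGroup E] [NormedSpace ℝ E]
  {H : Type*} [TopologicalSpace H] (I : ModelWithCorners ℝ E H)

/-- `Ω⁰(G, 𝔤)`: the smooth maps `G → 𝔤`. The Lie algebra `𝔤 = GroupLieAlgebra I G = T_e G` is, as
a vector space, the model space `E` (every tangent space is, by definition, in Mathlib). -/
abbrev Omega0 (G : Type*) [TopologicalSpace G] [ChartedSpace H G] : Type _ :=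
  C^∞⟮I, G; 𝓘(ℝ, E), E⟯

variable {G : Type*} [TopologicalSpace G] [ChartedSpace H G]

theorem mk_congr {a b : G} (h : a = b) (v : E) :
    (⟨a, v⟩ : TangentBundle I G) = ⟨b, v⟩ := by
  subst h; rfl

theorem mfderiv_comp_eq {f k : G → G} {a b : G} (hb : f a = b) (hk : MDifferentiableAt I I k b)
    (hf : MDifferentiableAt I I f a) (v : E) :
    (mfderiv I I k b (mfderiv I I f a v : E) : E) = mfderiv I I (k ∘ f) a v := by
  subst hb
  exact (mfderiv_comp_apply (I := I) (I' := I) (I'' := I) a hk hf v).symm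

theorem mfderiv_comp_eq_self {f k : G → G} {a b : G} (hb : f a = b)
    (hk : MDifferentiableAt I I k b) (hf : MDifferentiableAt I I f a) (hid : k ∘ f = id) (v : E) :
    (mfderiv I I k b (mfderiv I I f a v : E) : E) = v := by
  rw [mfderiv_comp_eq I hb hk hf, hid, mfderiv_id]
  rfl

variable [Group G]

/-- `T_e L_g : 𝔤 → T_g G`, the differential at the identity of `h ↦ g h`. Its value at `v` is
the infinitesimal right action `d/dt|_{t=0} g exp(t v)`. -/
def tangentLeft (g : G) (v : GroupLieAlgebra I G) : TangentSpace I g :=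
  mfderiv I I (fun h : G => g * h) 1 v

/-- `T_e R_g : 𝔤 → T_g G`, the differential at the identity of `h ↦ h g`. Its value at `v` is
the infinitesimal left action `d/dt|_{t=0} exp(t v) g`. -/
def tangentRight (g : G) (v : GroupLieAlgebra I G) : TangentSpace I g :=
  mfderiv I I (fun h : G => h * g) 1 v

/-- The left Maurer–Cartan form `ω_g : T_g G → 𝔤`, `ω_g(w) = T L_{g⁻¹} w`. -/
def leftMC (g : G) (w : TangentSpace I g) : GroupLieAlgebra I G :=
  mfderiv I I (fun h : G => g⁻¹ * h) g w

/-- The right Maurer–Cartan form `T_g G → 𝔤`, `w ↦ T R_{g⁻¹} w`. -/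
def rightMC (g : G) (w : TangentSpace I g) : GroupLieAlgebra I G :=
  mfderiv I I (fun h : G => h * g⁻¹) g w

/-- The vector field `ρ_*(x)` on `G`: `ρ_*(x)(g) = T L_g (x(g)) = d/dt|_{t=0} g exp(t x(g))`. -/
def rhoStar (x : Omega0 I G) (g : G) : TangentSpace I g := tangentLeft I g (x g)

/-- The vector field `λ_*(x)` on `G`: `λ_*(x)(g) = T R_g (x(g)) = d/dt|_{t=0} exp(t x(g)) g`. -/
def lambdaStar (x : Omega0 I G) (g : G) : TangentSpace I g := tangentRight I g (x g)

/-- The Lie bracket of `𝔤`, in the convention in which `𝔤 = T_e G` is identified with the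
right-invariant vector fields: the value at the identity of the Jacobi–Lie bracket
(`⟦X,Y⟧φ = X(Yφ) - Y(Xφ)`) of the right-invariant fields generated by `v` and `w`. -/
def rightBracket (v w : GroupLieAlgebra I G) : GroupLieAlgebra I G :=
  VectorField.mlieBracket I (fun g => tangentRight I g v) (fun g => tangentRight I g w) (1 : G)

theorem rightField_add (v w : E) : (fun g : G => tangentRight I g (v + w)) =
    (fun g : G => tangentRight I g v) + fun g : G => tangentRight I g w := by
  ext g; exact (mfderiv I I (fun h : G => h * g) 1).map_add v w

theorem rightField_smul (c : ℝ) (v : E) : (fun g : G => tangentRight I g (c • v)) =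
    c • (fun g : G => tangentRight I g v) := by
  ext g; exact (mfderiv I I (fun h : G => h * g) 1).map_smul c v

section Smoothness

variable [LieGroup I ∞ G]

theorem contMDiff_mk_one {f : G → E} :
    ContMDiff I I.tangent ∞ (fun g => (⟨1, f g⟩ : TangentBundle I G)) ↔
      ContMDiff I 𝓘(ℝ, E) ∞ f := by
  have key : ∀ g : G, ((trivializationAt E (TangentSpace I) (1 : G))
      (⟨1, f g⟩ : TangentBundle I G)).2 = f g := by
    intro g
    exact (tangentBundleCore I G).coordChange_self (achart H (1 : G)) 1 (mem_chart_source H 1) (f g)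
  refine forall_congr' fun g => ?_
  rw [Bundle.contMDiffAt_totalSpace]
  simp only [key]
  exact ⟨fun h => h.2, fun h => ⟨contMDiffAt_const, h⟩⟩

/-- Smooth dependence on `g` of the differential at `h = 1` of `h ↦ F (g, h)`. -/
theorem contMDiff_mfderiv_snd {F : G × G → G} (hF : ContMDiff (I.prod I) I ∞ F)
    {x : G → E} (hx : ContMDiff I 𝓘(ℝ, E) ∞ x) :
    ContMDiff I I.tangent ∞ (fun g => (⟨F (g, 1), mfderiv I I (fun h : G => F (g, h)) 1 (x g)⟩ :
      TangentBundle I G)) := by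
  let F₁ : G → TangentBundle I G × TangentBundle I G := fun g => (⟨g, 0⟩, ⟨1, x g⟩)
  have S₁ : ContMDiff I (I.tangent.prod I.tangent) ∞ F₁ :=
    (Bundle.contMDiff_zeroSection ℝ _).prodMk ((contMDiff_mk_one I).2 hx)
  have S₂ : ContMDiff (I.tangent.prod I.tangent) (I.prod I).tangent ∞
      (equivTangentBundleProd I G I G).symm := contMDiff_equivTangentBundleProd_symm
  have S₃ : ContMDiff (I.prod I).tangent I.tangent ∞ (tangentMap (I.prod I) I F) :=
    hF.contMDiff_tangentMap (m := ∞) (by simp)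
  convert! (S₃.comp S₂).comp S₁ with g
  simp only [Function.comp_apply, tangentMap, F₁]
  rw [mfderiv_prod_eq_add_apply (hF.mdifferentiable (by simp) _)]
  simp only [equivTangentBundleProd, Equiv.coe_fn_symm_mk]
  have h0 : ∀ L : E →L[ℝ] E, ∀ w : E, w = L 0 + w := fun L w => by simp
  exact h0 _ _

theorem contMDiff_tangentLeft {x : G → E} (hx : ContMDiff I 𝓘(ℝ, E) ∞ x) :
    ContMDiff I I.tangent ∞ (fun g => (⟨g, tangentLeft I g (x g)⟩ : TangentBundle I G)) :=
  (contMDiff_mfderiv_snd I (contMDiff_mul I ∞ (G := G)) hx).congr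
    fun g => mk_congr I (mul_one g).symm _

theorem contMDiff_tangentRight {x : G → E} (hx : ContMDiff I 𝓘(ℝ, E) ∞ x) :
    ContMDiff I I.tangent ∞ (fun g => (⟨g, tangentRight I g (x g)⟩ : TangentBundle I G)) :=
  (contMDiff_mfderiv_snd I (F := fun p : G × G => p.2 * p.1)
    (contMDiff_snd.mul contMDiff_fst) hx).congr fun g => mk_congr I (one_mul g).symm _

theorem mdiff_mulLeft (a b : G) : MDifferentiableAt I I (fun h : G => a * h) b :=
  (contMDiff_mul_left (I := I) (n := ∞)).mdifferentiable (by simp) b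

theorem mdiff_mulRight (a b : G) : MDifferentiableAt I I (fun h : G => h * a) b :=
  (contMDiff_mul_right (I := I) (n := ∞)).mdifferentiable (by simp) b

/-- `d/dt|_{t=0} g γ(t) = T_e L_g (γ'(0))` for every curve `γ` with `γ(0) = e`, such as
`γ(t) = exp(t v)`. -/
theorem velocity_mul_left (g : G) {γ : ℝ → G} (h0 : γ 0 = 1)
    (hγ : MDifferentiableAt 𝓘(ℝ, ℝ) I γ 0) :
    (mfderiv 𝓘(ℝ, ℝ) I (fun t => g * γ t) 0 (1 : ℝ) : E) =
      tangentLeft I g (mfderiv 𝓘(ℝ, ℝ) I γ 0 (1 : ℝ) : E) := by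
  unfold tangentLeft
  rw [← h0]
  exact mfderiv_comp_apply (I := 𝓘(ℝ, ℝ)) (I' := I) (I'' := I) 0
    (g := fun h : G => g * h) (mdiff_mulLeft I _ _) hγ (1 : ℝ)

/-- `d/dt|_{t=0} γ(t) g = T_e R_g (γ'(0))` for every curve `γ` with `γ(0) = e`, such as
`γ(t) = exp(t v)`. -/
theorem velocity_mul_right (g : G) {γ : ℝ → G} (h0 : γ 0 = 1)
    (hγ : MDifferentiableAt 𝓘(ℝ, ℝ) I γ 0) :
    (mfderiv 𝓘(ℝ, ℝ) I (fun t => γ t * g) 0 (1 : ℝ) : E) =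
      tangentRight I g (mfderiv 𝓘(ℝ, ℝ) I γ 0 (1 : ℝ) : E) := by
  unfold tangentRight
  rw [← h0]
  exact mfderiv_comp_apply (I := 𝓘(ℝ, ℝ)) (I' := I) (I'' := I) 0
    (g := fun h : G => h * g) (mdiff_mulRight I _ _) hγ (1 : ℝ)

theorem leftMC_tangentRight (g : G) (v : E) :
    leftMC I g (tangentRight I g v) = mfderiv I I (fun h : G => g⁻¹ * (h * g)) 1 v :=
  mfderiv_comp_eq I (f := fun h => h * g) (one_mul g) (mdiff_mulLeft I _ _) (mdiff_mulRight I _ _) v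

theorem rightMC_tangentLeft (g : G) (v : E) :
    rightMC I g (tangentLeft I g v) = mfderiv I I (fun h : G => (g * h) * g⁻¹) 1 v :=
  mfderiv_comp_eq I (mul_one g) (mdiff_mulRight I _ _) (mdiff_mulLeft I _ _) v

theorem leftMC_tangentLeft (g : G) (v : E) : leftMC I g (tangentLeft I g v) = v :=
  mfderiv_comp_eq_self I (mul_one g) (mdiff_mulLeft I _ _) (mdiff_mulLeft I _ _)
    (by ext; simp) v

theorem tangentLeft_leftMC (g : G) (w : E) : tangentLeft I g (leftMC I g w) = w :=
  mfderiv_comp_eq_self I (inv_mul_cancel g) (mdiff_mulLeft I _ _) (mdiff_mulLeft I _ _)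
    (by ext; simp) w

theorem rightMC_tangentRight (g : G) (v : E) : rightMC I g (tangentRight I g v) = v :=
  mfderiv_comp_eq_self I (f := fun h => h * g) (one_mul g) (mdiff_mulRight I _ _) (mdiff_mulRight I _ _)
    (by ext; simp) v

theorem tangentRight_rightMC (g : G) (w : E) : tangentRight I g (rightMC I g w) = w :=
  mfderiv_comp_eq_self I (f := fun h => h * g⁻¹) (mul_inv_cancel g) (mdiff_mulRight I _ _)
    (mdiff_mulRight I _ _) (by ext; simp) w

theorem contMDiff_leftMC_tangentRight {x : G → E} (hx : ContMDiff I 𝓘(ℝ, E) ∞ x) :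
    ContMDiff I 𝓘(ℝ, E) ∞ (M' := E) (fun g => leftMC I g (tangentRight I g (x g))) := by
  refine (contMDiff_mk_one I).1 ?_
  refine (contMDiff_mfderiv_snd I (F := fun p : G × G => p.1⁻¹ * (p.2 * p.1))
    ((contMDiff_fst.inv).mul (contMDiff_snd.mul contMDiff_fst)) hx).congr fun g => ?_
  rw [leftMC_tangentRight]
  exact mk_congr I (by simp) _

theorem contMDiff_rightMC_tangentLeft {x : G → E} (hx : ContMDiff I 𝓘(ℝ, E) ∞ x) :
    ContMDiff I 𝓘(ℝ, E) ∞ (M' := E) (fun g => rightMC I g (tangentLeft I g (x g))) := by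
  refine (contMDiff_mk_one I).1 ?_
  refine (contMDiff_mfderiv_snd I (F := fun p : G × G => (p.1 * p.2) * p.1⁻¹)
    ((contMDiff_fst.mul contMDiff_snd).mul contMDiff_fst.inv) hx).congr fun g => ?_
  rw [rightMC_tangentLeft]
  exact mk_congr I (by simp) _

/-- The Lie derivative of a smooth function along a smooth vector field is smooth. -/
theorem contMDiff_lieDeriv {V : ∀ g : G, TangentSpace I g}
    (hV : ContMDiff I I.tangent ∞ (fun g => (⟨g, V g⟩ : TangentBundle I G)))
    (y : Omega0 I G) :
    ContMDiff I 𝓘(ℝ, E) ∞ (fun g => (mfderiv I 𝓘(ℝ, E) y g (V g) : E)) :=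
  (contMDiff_snd_tangentBundle_modelSpace E 𝓘(ℝ, E)).comp
    ((y.contMDiff.contMDiff_tangentMap (m := ∞) (by simp)).comp hV)

theorem mdiff_rightField (v : E) (g : G) : MDifferentiableAt I I.tangent
    (fun g => (⟨g, tangentRight I g v⟩ : TangentBundle I G)) g :=
  (contMDiff_tangentRight I (x := fun _ => v) contMDiff_const).mdifferentiable (by simp) g

variable (G) in
/-- `rightBracket` as a bilinear map. -/
def rightBracketBilin [CompleteSpace E] : E →ₗ[ℝ] E →ₗ[ℝ] E :=
  have : IsManifold I 2 G := IsManifold.of_le (n := ∞) (by norm_cast)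
  LinearMap.mk₂ ℝ (fun v w => (rightBracket I (G := G) v w : E))
    (fun u v w => by
      simp only [rightBracket, rightField_add]
      exact VectorField.mlieBracket_add_left (mdiff_rightField I _ _) (mdiff_rightField I _ _))
    (fun c v w => by
      simp only [rightBracket, rightField_smul]
      exact VectorField.mlieBracket_const_smul_left (mdiff_rightField I _ _))
    (fun u v w => by
      simp only [rightBracket, rightField_add]
      exact VectorField.mlieBracket_add_right (mdiff_rightField I _ _) (mdiff_rightField I _ _))
    (fun c v w => by
      simp only [rightBracket, rightField_smul]
      exact VectorField.mlieBracket_const_smul_right (mdiff_rightField I _ _))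

theorem contMDiff_rightBracket [FiniteDimensional ℝ E] (x y : Omega0 I G) :
    ContMDiff I 𝓘(ℝ, E) ∞ (M' := E) (fun g => rightBracket I (G := G) (x g) (y g)) := by
  have : CompleteSpace E := FiniteDimensional.complete ℝ E
  let B : E →L[ℝ] E →L[ℝ] E :=
    (LinearMap.toContinuousLinearMap.toLinearMap ∘ₗ rightBracketBilin I G).toContinuousLinearMap
  have h : ContMDiff I 𝓘(ℝ, E) ∞ (fun g => B (x g) (y g)) :=
    (B.contMDiff.comp x.contMDiff).clm_apply y.contMDiff
  exact h

/-- The product `x ▷̃ y = ρ_*(x)(y)`, the Lie derivative of `y` along `ρ_*(x)`. -/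
def leftConn (x y : Omega0 I G) : Omega0 I G :=
  ⟨fun g => (mfderiv I 𝓘(ℝ, E) y g (rhoStar I x g) : E),
    contMDiff_lieDeriv I (contMDiff_tangentLeft I x.contMDiff) y⟩

/-- The product `x ▷ y = λ_*(x)(y)`, the Lie derivative of `y` along `λ_*(x)`. -/
def rightConn (x y : Omega0 I G) : Omega0 I G :=
  ⟨fun g => (mfderiv I 𝓘(ℝ, E) y g (lambdaStar I x g) : E),
    contMDiff_lieDeriv I (contMDiff_tangentRight I x.contMDiff) y⟩

/-- The pointwise bracket `[x,y](g) = [x(g), y(g)]_𝔤`. -/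
def bracket [FiniteDimensional ℝ E] (x y : Omega0 I G) : Omega0 I G :=
  ⟨fun g => (rightBracket I (G := G) (x g) (y g) : E), contMDiff_rightBracket I x y⟩

variable (G) in
/-- The correspondence between right and left trivializations of vector fields: it sends `x'` to
the function `x = ω(λ_*(x'))`, i.e. to the unique `x` with `ρ_*(x) = λ_*(x')`
(so `x(g) = Ad_{g⁻¹} x'(g)`). -/
def rightToLeft : Omega0 I G ≃ Omega0 I G where
  toFun x := ⟨fun g => (leftMC I g (lambdaStar I x g) : E),
    contMDiff_leftMC_tangentRight I x.contMDiff⟩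
  invFun x := ⟨fun g => (rightMC I g (rhoStar I x g) : E),
    contMDiff_rightMC_tangentLeft I x.contMDiff⟩
  left_inv x := by
    ext g
    exact (congrArg (rightMC I g) (tangentLeft_leftMC I g _)).trans
      (rightMC_tangentRight I g (x g))
  right_inv x := by
    ext g
    exact (congrArg (leftMC I g) (tangentRight_rightMC I g _)).trans
      (leftMC_tangentLeft I g (x g))

end Smoothness

end

end LieFun

/-!
The derivative of a vector-valued function along a Lie bracket of vector fields is the commutator
of its derivatives along the two fields. Hence a differentiable map sends brackets to brackets of
related fields. For the multiplication `G × G → G` this says that left- and right-invariant fields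
commute; for the inversion, that the bracket of right-invariant fields is the negative of the
bracket of left-invariant ones.

A vector field `ρ_*(y)` with variable coefficients is a combination of left-invariant fields, so
`⟦ρ_*(x), ρ_*(y)⟧ = ρ_*(x ▷̃ y - y ▷̃ x - [x, y])`. Differentiating a `𝔤`-valued function along
both sides is the curvature identity of the post-Lie structure. If `ρ_*(y) = λ_*(y')`, the bracket
of this field with the left-invariant field of `v` is `ρ_*(v ▷̃ y - [v, y])` from the first
description and `λ_*(v ▷̃ y')` from the second, and equating them gives the relation between
`▷̃` and `▷`.
-/

namespace LieFun

open Set Filter VectorField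
open scoped Topology

section Chart

variable {𝕜 : Type*} [NontriviallyNormedField 𝕜]
  {E : Type*} [NormedAddCommGroup E] [NormedSpace 𝕜 E]
  {H : Type*} [TopologicalSpace H] {I : ModelWithCorners 𝕜 E H}
  {M : Type*} [TopologicalSpace M] [ChartedSpace H M]
  {F : Type*} [NormedAddCommGroup F] [NormedSpace 𝕜 F]

theorem eventually_mdifferentiableAt [IsManifold I 1 M] {f : M → F} {x : M} (hf : CMDiffAt 1 f x) :
    ∀ᶠ p in 𝓝 x, MDiffAt f p := by
  filter_upwards [(contMDiffAt_iff_contMDiffAt_nhds (by simp)).1 hf] with p hp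
    using hp.mdifferentiableAt one_ne_zero

theorem fderivWithin_comp_extChartAt_symm [IsManifold I 1 M] {f : M → F} {x : M} {e : E}
    (he : e ∈ (extChartAt I x).target) (hf : MDiffAt f ((extChartAt I x).symm e)) :
    fderivWithin 𝕜 (f ∘ (extChartAt I x).symm) (range I) e =
      d% f ((extChartAt I x).symm e) ∘L
        mfderivWithin 𝓘(𝕜, E) I (extChartAt I x).symm (range I) e := by
  rw [← mfderivWithin_eq_fderivWithin,
    mfderiv_comp_mfderivWithin e hf (mdifferentiableWithinAt_extChartAt_symm he)
      (I.uniqueMDiffOn e (extChartAt_target_subset_range x he))]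
  rfl

/-- The vector field `V` read in the extended chart at `x`: the pullback of `V` along the inverse
chart, as a vector field on `range I ⊆ E`. It represents `V` on the chart target only. -/
noncomputable def chartField (I : ModelWithCorners 𝕜 E H) (x : M)
    (V : ∀ p : M, TangentSpace I p) (e : E) : E :=
  mpullbackWithin 𝓘(𝕜, E) I (extChartAt I x).symm V (range I) e

variable {f : M → F} {x : M} {V W : ∀ p : M, TangentSpace I p}

theorem mvfderiv_eq_fderivWithin_extChartAt (hf : MDiffAt f x) (v : TangentSpace I x) :
    d% f x v = fderivWithin 𝕜 (f ∘ (extChartAt I x).symm) (range I) (extChartAt I x x) v :=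
  DFunLike.congr_fun (if_pos hf) v

variable [IsManifold I 2 M]

theorem chartField_self : chartField I x V (extChartAt I x x) = V x :=
  (mfderivWithin_extChartAt_symm_inverse_apply (I := I) (x := x) _).trans
    (congrArg (fun p => (V p : E)) (extChartAt_to_inv x))

theorem mlieBracket_eq_lieBracketWithin_chartField :
    mlieBracket I V W x =
      lieBracketWithin 𝕜 (chartField I x V) (chartField I x W) (range I) (extChartAt I x x) := by
  rw [mlieBracket, mlieBracketWithin_apply, preimage_univ, univ_inter, mfderiv_extChartAt_self]
  exact DFunLike.congr_fun ContinuousLinearMap.inverse_id _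

theorem fderivWithin_chartField_eventuallyEq (hf : CMDiffAt 1 f x) :
    (fun e => fderivWithin 𝕜 (f ∘ (extChartAt I x).symm) (range I) e (chartField I x V e))
      =ᶠ[𝓝[range I] (extChartAt I x x)] (fun p => d% f p (V p)) ∘ (extChartAt I x).symm := by
  have hf' := eventually_mdifferentiableAt hf
  rw [← map_extChartAt_symm_nhdsWithin_range (I := I) x] at hf'
  filter_upwards [extChartAt_target_mem_nhdsWithin x, hf'] with e he hfe
  rw [fderivWithin_comp_extChartAt_symm he hfe]
  exact congrArg _ ((isInvertible_mfderivWithin_extChartAt_symm he).self_apply_inverse _)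

variable [CompleteSpace E]

theorem differentiableWithinAt_chartField (hV : MDiffAt (T% V) x) :
    DifferentiableWithinAt 𝕜 (chartField I x V) (range I) (extChartAt I x x) := by
  simpa only [preimage_univ, univ_inter] using!
    hV.mdifferentiableWithinAt (s := univ).differentiableWithinAt_mpullbackWithin_vectorField

theorem mdifferentiableAt_mvfderiv_apply (hf : CMDiffAt 2 f x)
    (hV : MDiffAt (T% V) x) : MDiffAt (fun p => d% f p (V p)) x := by
  have hdf : DifferentiableWithinAt 𝕜 (fderivWithin 𝕜 (f ∘ (extChartAt I x).symm) (range I))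
      (range I) (extChartAt I x x) :=
    ((contMDiffAt_iff.1 hf).2.fderivWithin_right I.uniqueDiffOn one_add_one_eq_two.le
      (mem_range_self _)).differentiableWithinAt one_ne_zero
  rw [← mdifferentiableWithinAt_univ]
  apply DifferentiableWithinAt.mdifferentiableWithinAt_of_comp_extChartAt_symm
  rw [preimage_univ, univ_inter]
  exact (hdf.clm_apply (differentiableWithinAt_chartField hV)).congr_of_eventuallyEq_of_mem
    (fderivWithin_chartField_eventuallyEq (hf.of_le one_le_two)).symm (mem_range_self _)

theorem mvfderiv_mlieBracket {n : ℕ∞ω} (hf : CMDiffAt n f x) (hn : minSmoothness 𝕜 2 ≤ n)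
    (hV : MDiffAt (T% V) x) (hW : MDiffAt (T% W) x) :
    d% f x (mlieBracket I V W x) =
      d% (fun p => d% f p (W p)) x (V x) - d% (fun p => d% f p (V p)) x (W x) := by
  have hf₂ : CMDiffAt 2 f x := hf.of_le (le_minSmoothness.trans hn)
  have hf₁ : CMDiffAt 1 f x := hf₂.of_le one_le_two
  have hf' : ContDiffWithinAt 𝕜 n (f ∘ (extChartAt I x).symm) (range I) (extChartAt I x x) :=
    (contMDiffAt_iff.1 hf).2
  have hx := mem_range_self (f := I) (chartAt H x x)
  have hVx := chartField_self (I := I) (x := x) (V := V)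
  have hWx := chartField_self (I := I) (x := x) (V := W)
  rw [mvfderiv_eq_fderivWithin_extChartAt (hf₁.mdifferentiableAt one_ne_zero),
    mvfderiv_eq_fderivWithin_extChartAt (mdifferentiableAt_mvfderiv_apply hf₂ hW),
    mvfderiv_eq_fderivWithin_extChartAt (mdifferentiableAt_mvfderiv_apply hf₂ hV),
    ← (fderivWithin_chartField_eventuallyEq hf₁).fderivWithin_eq_of_mem hx,
    ← (fderivWithin_chartField_eventuallyEq hf₁).fderivWithin_eq_of_mem hx,
    mlieBracket_eq_lieBracketWithin_chartField,
    fderivWithin_apply_lieBracket hf' hn I.uniqueDiffOn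
      (I.range_subset_closure_interior hx) hx (differentiableWithinAt_chartField hW)
      (differentiableWithinAt_chartField hV), hVx, hWx]

end Chart

section Related

variable {𝕜 : Type*} [NontriviallyNormedField 𝕜]
  {E : Type*} [NormedAddCommGroup E] [NormedSpace 𝕜 E]
  {H : Type*} [TopologicalSpace H] {I : ModelWithCorners 𝕜 E H}
  {M : Type*} [TopologicalSpace M] [ChartedSpace H M] [IsManifold I 2 M]
  {E' : Type*} [NormedAddCommGroup E'] [NormedSpace 𝕜 E']
  {H' : Type*} [TopologicalSpace H'] {I' : ModelWithCorners 𝕜 E' H'}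
  {N : Type*} [TopologicalSpace N] [ChartedSpace H' N] [IsManifold I' 2 N]
  {F : Type*} [NormedAddCommGroup F] [NormedSpace 𝕜 F]

variable [CompleteSpace E']

theorem mvfderiv_mvfderiv_comp_apply_of_related {f : M → N} {φ : N → F} {x : M}
    {V : ∀ p : M, TangentSpace I p} {V' : ∀ q : N, TangentSpace I' q}
    (hf : CMDiffAt 2 f x) (hφ : CMDiffAt 2 φ (f x)) (hV' : MDiffAt (T% V') (f x))
    (hVV' : ∀ᶠ p in 𝓝 x, mfderiv I I' f p (V p) = V' (f p)) (w : TangentSpace I x) :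
    d% (fun p => d% (φ ∘ f) p (V p)) x w =
      d% (fun q => d% φ q (V' q)) (f x) (mfderiv I I' f x w) := by
  have hf_nhds : ∀ᶠ p in 𝓝 x, CMDiffAt 2 f p := (contMDiffAt_iff_contMDiffAt_nhds (by simp)).1 hf
  have hφ_nhds := hf.continuousAt.eventually (eventually_mdifferentiableAt (hφ.of_le one_le_two))
  have chain_rule :
      (fun p => d% (φ ∘ f) p (V p)) =ᶠ[𝓝 x] (fun q => d% φ q (V' q)) ∘ f := by
    filter_upwards [hf_nhds, hφ_nhds, hVV'] with p hfp hφp hVp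
    rw [Function.comp_apply, ← hVp]
    exact mfderiv_comp_apply p hφp (hfp.mdifferentiableAt two_ne_zero) (V p)
  exact (DFunLike.congr_fun chain_rule.mfderiv_eq w).trans
    (mfderiv_comp_apply x (mdifferentiableAt_mvfderiv_apply hφ hV')
      (hf.mdifferentiableAt two_ne_zero) w)

variable [CompleteSpace E]

theorem mvfderiv_comp_mlieBracket_of_related {n : ℕ∞ω} (hn : minSmoothness 𝕜 2 ≤ n)
    {f : M → N} {φ : N → F} {x : M}
    {V W : ∀ p : M, TangentSpace I p} {V' W' : ∀ q : N, TangentSpace I' q}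
    (hf : CMDiffAt n f x) (hφ : CMDiffAt n φ (f x))
    (hV : MDiffAt (T% V) x) (hW : MDiffAt (T% W) x)
    (hV' : MDiffAt (T% V') (f x)) (hW' : MDiffAt (T% W') (f x))
    (hVV' : ∀ᶠ p in 𝓝 x, mfderiv I I' f p (V p) = V' (f p))
    (hWW' : ∀ᶠ p in 𝓝 x, mfderiv I I' f p (W p) = W' (f p)) :
    d% (φ ∘ f) x (mlieBracket I V W x) = d% φ (f x) (mlieBracket I' V' W' (f x)) := by
  have hf₂ : CMDiffAt 2 f x := hf.of_le (le_minSmoothness.trans hn)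
  have hφ₂ : CMDiffAt 2 φ (f x) := hφ.of_le (le_minSmoothness.trans hn)
  rw [mvfderiv_mlieBracket (hφ.comp x hf) hn hV hW, mvfderiv_mlieBracket hφ hn hV' hW',
    mvfderiv_mvfderiv_comp_apply_of_related hf₂ hφ₂ hW' hWW',
    mvfderiv_mvfderiv_comp_apply_of_related hf₂ hφ₂ hV' hVV',
    hVV'.self_of_nhds, hWW'.self_of_nhds]

theorem mfderiv_mlieBracket_of_related {n : ℕ∞ω} (hn : minSmoothness 𝕜 2 ≤ n) [IsManifold I' n N]
    {f : M → N} {x : M}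
    {V W : ∀ p : M, TangentSpace I p} {V' W' : ∀ q : N, TangentSpace I' q}
    (hf : CMDiffAt n f x) (hV : MDiffAt (T% V) x) (hW : MDiffAt (T% W) x)
    (hV' : MDiffAt (T% V') (f x)) (hW' : MDiffAt (T% W') (f x))
    (hVV' : ∀ᶠ p in 𝓝 x, mfderiv I I' f p (V p) = V' (f p))
    (hWW' : ∀ᶠ p in 𝓝 x, mfderiv I I' f p (W p) = W' (f p)) :
    mfderiv I I' f x (mlieBracket I V W x) = mlieBracket I' V' W' (f x) := by
  have hφ : CMDiffAt n (extChartAt I' (f x)) (f x) := contMDiffAt_extChartAt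
  have hn₀ : n ≠ 0 := (two_pos.trans_le (le_minSmoothness.trans hn)).ne'
  have hid (v : TangentSpace I' (f x)) : d% (extChartAt I' (f x)) (f x) v = v :=
    DFunLike.congr_fun (mfderiv_extChartAt_self (I := I') (x := f x)) v
  rw [← hid (mfderiv I I' f x _), ← hid (mlieBracket I' V' W' (f x)),
    ← mvfderiv_comp_mlieBracket_of_related hn hf hφ hV hW hV' hW' hVV' hWW']
  exact (mfderiv_comp_apply x (hφ.mdifferentiableAt hn₀)
    (hf.mdifferentiableAt hn₀) _).symm

end Related

section Family

variable {𝕜 : Type*} [NontriviallyNormedField 𝕜]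
  {E : Type*} [NormedAddCommGroup E] [NormedSpace 𝕜 E]
  {H : Type*} [TopologicalSpace H] {I : ModelWithCorners 𝕜 E H}
  {M : Type*} [TopologicalSpace M] [ChartedSpace H M] {x : M}

theorem mvfderiv_continuousLinearMap_comp_apply {F F' : Type*} [NormedAddCommGroup F]
    [NormedSpace 𝕜 F] [NormedAddCommGroup F'] [NormedSpace 𝕜 F'] (ℓ : F →L[𝕜] F') {a : M → F}
    (ha : MDiffAt a x) (v : TangentSpace I x) : d% (ℓ ∘ a) x v = ℓ (d% a x v) :=
  (mfderiv_comp_apply x ℓ.mdifferentiableAt ha v).trans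
    (DFunLike.congr_fun ℓ.mfderiv_eq (d% a x v))

variable [IsManifold I 2 M] [CompleteSpace E] {V : ∀ p : M, TangentSpace I p}

theorem mlieBracket_finset_sum_right {ι : Type*} (s : Finset ι)
    {W : ι → ∀ p : M, TangentSpace I p} (hW : ∀ i, MDiffAt (T% (W i)) x) :
    mlieBracket I V (∑ i ∈ s, W i) x = ∑ i ∈ s, mlieBracket I V (W i) x := by
  classical
  induction s using Finset.induction_on with
  | empty => simp only [Finset.sum_empty, mlieBracket_zero_right, Pi.zero_apply]
  | insert i s his ih =>
    have hs : MDiffAt (T% (∑ j ∈ s, W j)) x := by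
      simpa only [Finset.sum_fn] using! MDifferentiableAt.sum_section fun j _ => hW j
    rw [Finset.sum_insert his, Finset.sum_insert his, mlieBracket_add_right (hW i) hs, ih]

variable {D : Type*} [NormedAddCommGroup D] [NormedSpace 𝕜 D] [FiniteDimensional 𝕜 D]
  [CompleteSpace 𝕜]

theorem mlieBracket_linearFamily_right {T : ∀ p : M, D →ₗ[𝕜] TangentSpace I p} {a : M → D}
    (hT : ∀ v, MDiffAt (T% (fun p => T p v)) x) (ha : MDiffAt a x) :
    mlieBracket I V (fun p => T p (a p)) x =
      T x (d% a x (V x)) + mlieBracket I V (fun p => T p (a x)) x := by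
  let b := Module.finBasis 𝕜 D
  let ℓ i : D →L[𝕜] 𝕜 := (b.coord i).toContinuousLinearMap
  let W i : ∀ p : M, TangentSpace I p := fun p => T p (b i)
  have expand (c : D) (p : M) : T p c = ∑ i, ℓ i c • W i p :=
    calc T p c = T p (∑ i, ℓ i c • b i) := congrArg _ (b.sum_repr c).symm
      _ = ∑ i, ℓ i c • W i p := by simp only [map_sum, map_smul, W]
  have hW i : MDiffAt (T% (W i)) x := hT (b i)
  have hℓ i : MDiffAt (ℓ i ∘ a) x := (ℓ i).mdifferentiableAt.comp x ha
  have hvar : (fun p => T p (a p)) = ∑ i, (ℓ i ∘ a) • W i := by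
    ext p : 1
    rw [expand, Finset.sum_apply]
    rfl
  have hconst : (fun p => T p (a x)) = ∑ i, ℓ i (a x) • W i := by
    ext p : 1
    rw [expand, Finset.sum_apply]
    rfl
  rw [hvar, hconst, mlieBracket_finset_sum_right _ fun i => (hℓ i).smul_section (hW i),
    mlieBracket_finset_sum_right _ fun i => (hW i).smul_const_section, expand,
    ← Finset.sum_add_distrib]
  refine Finset.sum_congr rfl fun i _ => ?_
  rw [mlieBracket_smul_right (hℓ i) (hW i), mlieBracket_const_smul_right (hW i),
    mvfderiv_continuousLinearMap_comp_apply (ℓ i) ha]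
  rfl

end Family

section Product

variable {𝕜 : Type*} [NontriviallyNormedField 𝕜]
  {E : Type*} [NormedAddCommGroup E] [NormedSpace 𝕜 E]
  {H : Type*} [TopologicalSpace H] {I : ModelWithCorners 𝕜 E H}
  {E' : Type*} [NormedAddCommGroup E'] [NormedSpace 𝕜 E']
  {H' : Type*} [TopologicalSpace H'] {I' : ModelWithCorners 𝕜 E' H'}
  {N : Type*} [TopologicalSpace N] [ChartedSpace H' N]
  {M : Type*} [TopologicalSpace M] [ChartedSpace H M]

/-- The vector field `(V, W)` on `M × N` with components `V` on `M` and `W` on `N`. -/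
def prodField (V : ∀ p : M, TangentSpace I p) (W : ∀ q : N, TangentSpace I' q) (p : M × N) :
    TangentSpace (I.prod I') p :=
  (V p.1, W p.2)

variable {V V' : ∀ p : M, TangentSpace I p} {W W' : ∀ q : N, TangentSpace I' q} {p : M × N}

theorem mdifferentiableAt_prodField [IsManifold I 1 M] [IsManifold I' 1 N]
    (hV : MDiffAt (T% V) p.1) (hW : MDiffAt (T% W) p.2) :
    MDiffAt (T% (prodField V W)) p := by
  have hVW : MDifferentiableAt (I.prod I') (I.tangent.prod I'.tangent)
      (fun q : M × N => ((⟨q.1, V q.1⟩ : TangentBundle I M),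
        (⟨q.2, W q.2⟩ : TangentBundle I' N))) p :=
    hV.prodMap hW
  exact (contMDiff_equivTangentBundleProd_symm.mdifferentiable one_ne_zero _).comp p hVW

variable [IsManifold I 2 M] [IsManifold I' 2 N] [CompleteSpace E] [CompleteSpace E']

theorem mlieBracket_prodField {n : ℕ∞ω} (hn : minSmoothness 𝕜 2 ≤ n) [IsManifold I n M]
    [IsManifold I' n N]
    (hV : MDiffAt (T% V) p.1) (hV' : MDiffAt (T% V') p.1)
    (hW : MDiffAt (T% W) p.2) (hW' : MDiffAt (T% W') p.2) :
    mlieBracket (I.prod I') (prodField V W) (prodField V' W') p =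
      prodField (mlieBracket I V V') (mlieBracket I' W W') p := by
  have hVW := mdifferentiableAt_prodField hV hW
  have hVW' := mdifferentiableAt_prodField hV' hW'
  have hfst := mfderiv_mlieBracket_of_related hn contMDiffAt_fst hVW hVW' hV hV'
    (.of_forall fun q => DFunLike.congr_fun mfderiv_fst (prodField V W q))
    (.of_forall fun q => DFunLike.congr_fun mfderiv_fst (prodField V' W' q))
  have hsnd := mfderiv_mlieBracket_of_related hn contMDiffAt_snd hVW hVW' hW hW'
    (.of_forall fun q => DFunLike.congr_fun mfderiv_snd (prodField V W q))
    (.of_forall fun q => DFunLike.congr_fun mfderiv_snd (prodField V' W' q))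
  rw [mfderiv_fst] at hfst
  rw [mfderiv_snd] at hsnd
  exact Prod.ext hfst hsnd

end Product

section Congr

variable {𝕜 : Type*} [NontriviallyNormedField 𝕜]
  {E : Type*} [NormedAddCommGroup E] [NormedSpace 𝕜 E]
  {H : Type*} [TopologicalSpace H] (I : ModelWithCorners 𝕜 E H)
  {M : Type*} [TopologicalSpace M] [ChartedSpace H M]
  {E' : Type*} [NormedAddCommGroup E'] [NormedSpace 𝕜 E']
  {H' : Type*} [TopologicalSpace H'] (I' : ModelWithCorners 𝕜 E' H')
  {N : Type*} [TopologicalSpace N] [ChartedSpace H' N]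

theorem mfderiv_apply_congr {f k : M → N} (h : f = k) (p : M) (v : E) :
    (mfderiv I I' f p v : E') = mfderiv I I' k p v := by
  subst h; rfl

end Congr

section Group

variable {E : Type*} [NormedAddCommGroup E] [NormedSpace ℝ E]
  {H : Type*} [TopologicalSpace H] (I : ModelWithCorners ℝ E H)
  {G : Type*} [TopologicalSpace G] [ChartedSpace H G] [Group G] [LieGroup I ∞ G]

theorem mdifferentiableAt_leftField (v : E) (g : G) :
    MDiffAt (T% (fun g : G => tangentLeft I g v)) g :=
  (contMDiff_tangentLeft I contMDiff_const).mdifferentiable (by simp) g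

theorem mfderiv_mul_apply (p : G × G) (u : TangentSpace (I.prod I) p) :
    mfderiv (I.prod I) I (fun q : G × G => q.1 * q.2) p u =
      (mfderiv I I (fun h => h * p.2) p.1 u.1 + mfderiv I I (fun h => p.1 * h) p.2 u.2 : E) :=
  mfderiv_prod_eq_add_apply ((contMDiff_mul I ∞).mdifferentiable (by simp) p)

theorem mfderiv_mulRight_tangentRight (g h : G) (v : E) :
    mfderiv I I (fun k => k * h) g (tangentRight I g v) = tangentRight I (g * h) v :=
  (mfderiv_comp_eq I (f := fun k => k * g) (one_mul g) (mdiff_mulRight I h g)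
    (mdiff_mulRight I g 1) v).trans
    (mfderiv_apply_congr I I (funext fun k => mul_assoc k g h) 1 v)

theorem mfderiv_mulLeft_tangentLeft (g h : G) (v : E) :
    mfderiv I I (fun k => g * k) h (tangentLeft I h v) = tangentLeft I (g * h) v :=
  (mfderiv_comp_eq I (mul_one h) (mdiff_mulLeft I g h) (mdiff_mulLeft I h 1) v).trans
    (mfderiv_apply_congr I I (funext fun k => (mul_assoc g h k).symm) 1 v)

theorem mdifferentiableAt_inv (g : G) : MDiffAt (fun h : G => h⁻¹) g :=
  (contMDiff_inv I ∞).mdifferentiable (by simp) g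

theorem mfderiv_mul_inv_one (v : E) :
    (mfderiv I I (fun h : G => h * h⁻¹) 1 v : E) =
      (mfderiv I I (fun h : G => h * 1⁻¹) 1 v : E) +
        (mfderiv I I (fun h : G => 1 * h) 1⁻¹ (mfderiv I I (fun h : G => h⁻¹) 1 v) : E) := by
  have dprod (w : E) : (mfderiv I (I.prod I) (fun h : G => (h, h⁻¹)) 1 w : E × E) =
      (w, (mfderiv I I (fun h : G => h⁻¹) 1 w : E)) :=
    (DFunLike.congr_fun
      (mfderiv_prodMk (mdifferentiableAt_id (I := I)) (mdifferentiableAt_inv I (1 : G))) w).trans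
      (congrArg (fun L : E →L[ℝ] E => (L w, (mfderiv I I (fun h : G => h⁻¹) 1 w : E)))
        (mfderiv_id (I := I) (x := (1 : G))))
  exact (mfderiv_comp_apply (1 : G)
    ((contMDiff_mul I (G := G) ∞).mdifferentiable (by simp) _)
    (mdifferentiableAt_id.prodMk (mdifferentiableAt_inv I 1)) v).trans
    ((mfderiv_mul_apply I (1, 1⁻¹) _).trans
      (congrArg (fun u : E × E => (mfderiv I I (fun h : G => h * 1⁻¹) 1 u.1 : E) +
        (mfderiv I I (fun h : G => 1 * h) 1⁻¹ u.2 : E)) (dprod v)))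

theorem mfderiv_inv_one (v : E) :
    mfderiv I I (fun h : G => h⁻¹) 1 v = (-v : E) := by
  have mul_one_eq_id : (fun h : G => h * 1⁻¹) = id := funext fun h => by simp
  have dmul_one : (mfderiv I I (fun h : G => h * 1⁻¹) 1 v : E) = v :=
    (mfderiv_apply_congr I I mul_one_eq_id 1 v).trans
      (DFunLike.congr_fun (mfderiv_id (I := I)) v)
  have done_mul (w : E) : (mfderiv I I (fun h : G => 1 * h) 1⁻¹ w : E) = w :=
    (mfderiv_apply_congr I I (k := id) (funext one_mul) _ w).trans
      (DFunLike.congr_fun (mfderiv_id (I := I)) w)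
  have dmul_inv : (mfderiv I I (fun h : G => h * h⁻¹) 1 v : E) = 0 :=
    (mfderiv_apply_congr I I (funext mul_inv_cancel) 1 v).trans
      (DFunLike.congr_fun (mfderiv_const (I := I) (I' := I)) v)
  let dinv : E →L[ℝ] E := mfderiv I I (fun h : G => h⁻¹) 1
  have sum_eq_zero : v + dinv v = 0 :=
    (congrArg₂ (· + · : E → E → E) dmul_one (done_mul (dinv v))).symm.trans
      ((mfderiv_mul_inv_one I v).symm.trans dmul_inv)
  exact eq_neg_of_add_eq_zero_right sum_eq_zero

theorem mfderiv_inv_tangentRight (g : G) (v : E) :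
    (mfderiv I I (fun h : G => h⁻¹) g (tangentRight I g v) : E) = tangentLeft I g⁻¹ (-v : E) := by
  have precomp : (mfderiv I I (fun h : G => h⁻¹) g (tangentRight I g v) : E) =
      mfderiv I I (fun h : G => (h * g)⁻¹) 1 v :=
    mfderiv_comp_eq I (f := fun h => h * g) (one_mul g) (mdifferentiableAt_inv I g)
      (mdiff_mulRight I g 1) v
  have inv_mul : (mfderiv I I (fun h : G => (h * g)⁻¹) 1 v : E) =
      mfderiv I I (fun h : G => g⁻¹ * h⁻¹) 1 v :=
    mfderiv_apply_congr I I (funext fun h => mul_inv_rev h g) 1 v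
  have postcomp : (mfderiv I I (fun h : G => g⁻¹ * h⁻¹) 1 v : E) =
      mfderiv I I (fun h : G => g⁻¹ * h) 1 (mfderiv I I (fun h : G => h⁻¹) 1 v : E) :=
    (mfderiv_comp_eq I inv_one (mdiff_mulLeft I g⁻¹ 1) (mdifferentiableAt_inv I 1) v).symm
  exact precomp.trans <| inv_mul.trans <| postcomp.trans <|
    congrArg (fun w : E => (mfderiv I I (fun h : G => g⁻¹ * h) 1 w : E)) (mfderiv_inv_one I v)

theorem minSmoothness_le_infty : minSmoothness ℝ 2 ≤ ∞ := by
  rw [minSmoothness_of_isRCLikeNormedField]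
  norm_cast

variable [CompleteSpace E]

-- The two invariant fields are the images under multiplication of fields tangent to different
-- factors of `G × G`, and those commute.
theorem mlieBracket_rightField_leftField (v w : E) (g : G) :
    mlieBracket I (fun h : G => tangentRight I h v) (fun h => tangentLeft I h w) g = 0 := by
  let R : ∀ p : G × G, TangentSpace (I.prod I) p := prodField (fun h => tangentRight I h v) 0
  let L : ∀ p : G × G, TangentSpace (I.prod I) p := prodField 0 (fun h => tangentLeft I h w)
  have hR (h : G) : MDiffAt (T% (fun h : G => tangentRight I h v)) h := mdiff_rightField I v h
  have hL (h : G) := mdifferentiableAt_leftField I w h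
  have h0 (h : G) : MDiffAt (T% (0 : ∀ h : G, TangentSpace I h)) h :=
    (Bundle.contMDiff_zeroSection (n := ∞) ℝ _).mdifferentiable (by simp) h
  have hbr : mlieBracket (I.prod I) R L ((g, 1) : G × G) = 0 := by
    have hprod := mlieBracket_prodField (n := ∞) (p := ((g, 1) : G × G)) minSmoothness_le_infty
      (hR _) (h0 _) (h0 _) (hL _)
    refine hprod.trans ?_
    rw [prodField, mlieBracket_zero_left, mlieBracket_zero_right]
    rfl
  have hmulR (p : G × G) : mfderiv (I.prod I) I (fun q : G × G => q.1 * q.2) p (R p) =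
      tangentRight I (p.1 * p.2) v :=
    (mfderiv_mul_apply I p (R p)).trans <|
      (congrArg₂ (· + · : E → E → E) (mfderiv_mulRight_tangentRight I p.1 p.2 v)
        (map_zero (mfderiv I I (fun h => p.1 * h) p.2))).trans (add_zero (_ : E))
  have hmulL (p : G × G) : mfderiv (I.prod I) I (fun q : G × G => q.1 * q.2) p (L p) =
      tangentLeft I (p.1 * p.2) w :=
    (mfderiv_mul_apply I p (L p)).trans <|
      (congrArg₂ (· + · : E → E → E) (map_zero (mfderiv I I (fun h => h * p.2) p.1))
        (mfderiv_mulLeft_tangentLeft I p.1 p.2 w)).trans (zero_add (_ : E))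
  have h := mfderiv_mlieBracket_of_related (n := ∞) minSmoothness_le_infty
    (contMDiff_mul I ∞ (G := G) (g, 1)) (mdifferentiableAt_prodField (hR _) (h0 _))
    (mdifferentiableAt_prodField (h0 _) (hL _)) (hR _) (hL _)
    (.of_forall hmulR) (.of_forall hmulL)
  rw [hbr, map_zero, mul_one] at h
  exact h.symm

instance lieGroup_minSmoothness : LieGroup I (minSmoothness ℝ 3) G :=
  .of_le (n := ∞) (by rw [minSmoothness_of_isRCLikeNormedField]; norm_cast)

theorem rightBracket_eq_neg_lie (v w : GroupLieAlgebra I G) : rightBracket I v w = -⁅v, w⁆ := by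
  have related (u : GroupLieAlgebra I G) (h : G) :
      mfderiv I I (fun h : G => h⁻¹) h (tangentRight I h u) = mulInvariantVectorField (-u) h⁻¹ :=
    mfderiv_inv_tangentRight I h u
  have map_bracket : mfderiv I I (fun h : G => h⁻¹) 1 (rightBracket I v w) =
      mlieBracket I (mulInvariantVectorField (-v)) (mulInvariantVectorField (-w)) (1 : G)⁻¹ :=
    mfderiv_mlieBracket_of_related (n := ∞) minSmoothness_le_infty
      (contMDiff_inv I ∞ (1 : G)) (mdiff_rightField I v 1) (mdiff_rightField I w 1)
      (mdifferentiableAt_leftField I (-v) _) (mdifferentiableAt_leftField I (-w) _)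
      (.of_forall (related v)) (.of_forall (related w))
  rw [inv_one] at map_bracket
  have neg_bracket : -rightBracket I v w = ⁅-v, -w⁆ :=
    (mfderiv_inv_one I (rightBracket I v w)).symm.trans map_bracket
  rw [neg_lie, lie_neg, neg_neg] at neg_bracket
  rw [← neg_bracket, neg_neg]

end Group

section Trivialization

variable {E : Type*} [NormedAddCommGroup E] [NormedSpace ℝ E]
  {H : Type*} [TopologicalSpace H] (I : ModelWithCorners ℝ E H)
  {G : Type*} [TopologicalSpace G] [ChartedSpace H G] [Group G]

/-- `tangentLeft I g` as a continuous linear map on the model space `E`, the space in which maps in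
`Ω⁰(G, 𝔤)` take their values. -/
noncomputable def tangentLeftL (g : G) : E →L[ℝ] TangentSpace I g :=
  mfderiv I I (fun h : G => g * h) 1

/-- `tangentRight I g` as a continuous linear map on the model space `E`, the space in which maps
in `Ω⁰(G, 𝔤)` take their values. -/
noncomputable def tangentRightL (g : G) : E →L[ℝ] TangentSpace I g :=
  mfderiv I I (fun h : G => h * g) 1

variable [FiniteDimensional ℝ E] [LieGroup I ∞ G]

theorem mlieBracket_tangentLeftL_right {V : ∀ g : G, TangentSpace I g} {y : G → E} {g : G}
    (hy : MDiffAt y g) :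
    mlieBracket I V (fun h => tangentLeftL I h (y h)) g =
      tangentLeftL I g (d% y g (V g)) + mlieBracket I V (fun h => tangentLeftL I h (y g)) g :=
  mlieBracket_linearFamily_right (T := fun h : G => (tangentLeftL I h).toLinearMap)
    (fun v => mdifferentiableAt_leftField I v g) hy

theorem mlieBracket_tangentRightL_right {V : ∀ g : G, TangentSpace I g} {y : G → E} {g : G}
    (hy : MDiffAt y g) :
    mlieBracket I V (fun h => tangentRightL I h (y h)) g =
      tangentRightL I g (d% y g (V g)) + mlieBracket I V (fun h => tangentRightL I h (y g)) g :=
  mlieBracket_linearFamily_right (T := fun h : G => (tangentRightL I h).toLinearMap)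
    (fun v => mdiff_rightField I v g) hy

theorem mlieBracket_leftField_leftField (v w : E) (g : G) :
    mlieBracket I (fun h => tangentLeftL I h v) (fun h => tangentLeftL I h w) g =
      -tangentLeftL I g (rightBracketBilin I G v w) := by
  have lie_eq : mlieBracket I (mulInvariantVectorField v) (mulInvariantVectorField w) (1 : G) =
      -rightBracket I v w :=
    (neg_eq_iff_eq_neg.2 (rightBracket_eq_neg_lie I v w)).symm
  exact (congrFun (mulInvariantVector_mlieBracket (I := I) (G := G) v w) g).symm.trans
    ((congrArg (tangentLeftL I g) lie_eq).trans (map_neg (tangentLeftL I g) _))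

theorem mlieBracket_leftField_tangentLeftL (v : E) {y : G → E} {g : G} (hy : MDiffAt y g) :
    mlieBracket I (fun h => tangentLeftL I h v) (fun h => tangentLeftL I h (y h)) g =
      tangentLeftL I g (d% y g (tangentLeftL I g v) - rightBracketBilin I G v (y g)) := by
  rw [mlieBracket_tangentLeftL_right I hy, mlieBracket_leftField_leftField, map_sub, sub_eq_add_neg]

theorem mlieBracket_leftField_tangentRightL (v : E) {y : G → E} {g : G} (hy : MDiffAt y g) :
    mlieBracket I (fun h => tangentLeftL I h v) (fun h => tangentRightL I h (y h)) g =
      tangentRightL I g (d% y g (tangentLeftL I g v)) := by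
  have commute : mlieBracket I (fun h => tangentRightL I h (y g))
      (fun h => tangentLeftL I h v) g = 0 :=
    mlieBracket_rightField_leftField I (y g) v g
  rw [mlieBracket_tangentRightL_right I hy, mlieBracket_swap_apply, commute, neg_zero, add_zero]

theorem rightBracketBilin_swap (v w : E) :
    rightBracketBilin I G v w = -rightBracketBilin I G w v :=
  mlieBracket_swap_apply

theorem mlieBracket_tangentLeftL_tangentLeftL {x y : G → E} {g : G} (hx : MDiffAt x g)
    (hy : MDiffAt y g) :
    mlieBracket I (fun h => tangentLeftL I h (x h)) (fun h => tangentLeftL I h (y h)) g =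
      tangentLeftL I g (d% y g (tangentLeftL I g (x g)) - d% x g (tangentLeftL I g (y g)) -
        rightBracketBilin I G (x g) (y g)) := by
  rw [mlieBracket_tangentLeftL_right I hy, mlieBracket_swap_apply,
    mlieBracket_leftField_tangentLeftL I _ hx, rightBracketBilin_swap I (y g), ← map_neg, ← map_add]
  congr 1
  abel

-- Both sides are the bracket of one vector field with the left-invariant field of `v`, expanded in
-- right- and in left-invariant fields.
theorem tangentRightL_mvfderiv {y y' : G → E} {g : G} (hy : MDiffAt y g) (hy' : MDiffAt y' g)
    (hyy' : ∀ h, tangentLeftL I h (y h) = tangentRightL I h (y' h)) (v : E) :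
    tangentRightL I g (d% y' g (tangentLeftL I g v)) =
      tangentLeftL I g (d% y g (tangentLeftL I g v) - rightBracketBilin I G v (y g)) := by
  rw [← mlieBracket_leftField_tangentLeftL I v hy, ← mlieBracket_leftField_tangentRightL I v hy',
    funext hyy']

end Trivialization

section Bilinear

variable {𝕜 : Type*} [NontriviallyNormedField 𝕜]
  {E : Type*} [NormedAddCommGroup E] [NormedSpace 𝕜 E]
  {H : Type*} [TopologicalSpace H] {I : ModelWithCorners 𝕜 E H}
  {M : Type*} [TopologicalSpace M] [ChartedSpace H M]
  {F F' F'' : Type*} [NormedAddCommGroup F] [NormedSpace 𝕜 F] [NormedAddCommGroup F']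
  [NormedSpace 𝕜 F'] [NormedAddCommGroup F''] [NormedSpace 𝕜 F'']

theorem mvfderiv_bilinear_apply (B : F →L[𝕜] F' →L[𝕜] F'') {a : M → F} {b : M → F'} {x : M}
    (ha : MDiffAt a x) (hb : MDiffAt b x) (v : TangentSpace I x) :
    d% (fun p => B (a p) (b p)) x v = B (d% a x v) (b x) + B (a x) (d% b x v) := by
  have hB : HasMFDerivAt 𝓘(𝕜, F × F') 𝓘(𝕜, F'') (fun q : F × F' => B q.1 q.2) (a x, b x)
      (B.isBoundedBilinearMap.deriv (a x, b x)) :=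
    (B.isBoundedBilinearMap.hasFDerivAt (a x, b x)).hasMFDerivAt
  have hab : HasMFDerivAt I 𝓘(𝕜, F × F') (fun p => (a p, b p)) x ((d% a x).prod (d% b x)) :=
    ⟨(ha.prodMk_space hb).continuousAt, ha.hasMFDerivAt.2.prodMk hb.hasMFDerivAt.2⟩
  exact (DFunLike.congr_fun (hB.comp x hab).mfderiv v).trans (add_comm _ _)

end Bilinear

section PostLie

variable {E : Type*} [NormedAddCommGroup E] [NormedSpace ℝ E]
  {H : Type*} [TopologicalSpace H] (I : ModelWithCorners ℝ E H)
  {G : Type*} [TopologicalSpace G] [ChartedSpace H G]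

theorem mdifferentiableAt_coe (x : Omega0 I G) (g : G) : MDiffAt x g :=
  x.contMDiff.mdifferentiable (by simp) g

variable [Group G] [LieGroup I ∞ G]

theorem leftConn_apply (x y : Omega0 I G) (g : G) :
    leftConn I x y g = d% y g (tangentLeftL I g (x g)) := rfl

variable [FiniteDimensional ℝ E]

theorem bracket_apply (x y : Omega0 I G) (g : G) :
    bracket I x y g = rightBracketBilin I G (x g) (y g) := rfl

theorem leftConn_eq_rightToLeft_rightConn_add_bracket (x y : Omega0 I G) :
    leftConn I x y =
      rightToLeft I G (rightConn I ((rightToLeft I G).symm x) ((rightToLeft I G).symm y)) +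
        bracket I x y := by
  ext g
  have right_repr (z : Omega0 I G) (h : G) :
      tangentLeftL I h (z h) = tangentRightL I h ((rightToLeft I G).symm z h) :=
    (tangentRight_rightMC I h _).symm
  have transported : rightToLeft I G
      (rightConn I ((rightToLeft I G).symm x) ((rightToLeft I G).symm y)) g =
        leftConn I x y g - bracket I x y g := by
    have field_eq : lambdaStar I ((rightToLeft I G).symm x) g = tangentLeftL I g (x g) :=
      (right_repr x g).symm
    have deriv_eq := tangentRightL_mvfderiv I (mdifferentiableAt_coe I y g)
      (mdifferentiableAt_coe I _ g) (right_repr y) (x g)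
    exact (congrArg (fun u => leftMC I g (tangentRightL I g
      (d% ((rightToLeft I G).symm y) g u))) field_eq).trans
      ((congrArg (leftMC I g) deriv_eq).trans (leftMC_tangentLeft I g _))
  exact sub_eq_iff_eq_add.1 transported.symm

theorem leftConn_neg_bracket (x y z : Omega0 I G) :
    leftConn I x (-bracket I y z) =
      -bracket I (leftConn I x y) z + -bracket I y (leftConn I x z) := by
  ext g
  let B : E →L[ℝ] E →L[ℝ] E :=
    (LinearMap.toContinuousLinearMap.toLinearMap ∘ₗ (-rightBracketBilin I G)).toContinuousLinearMap
  exact mvfderiv_bilinear_apply B (mdifferentiableAt_coe I y g) (mdifferentiableAt_coe I z g) _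

-- The field on the left is the bracket of `ρ_*(x)` and `ρ_*(y)`.
theorem leftConn_commutator (x y z : Omega0 I G) :
    leftConn I (leftConn I x y - leftConn I y x - bracket I x y) z =
      leftConn I x (leftConn I y z) - leftConn I y (leftConn I x z) := by
  ext g
  have field (w : Omega0 I G) : MDiffAt (T% (fun h => tangentLeftL I h (w h))) g :=
    (contMDiff_tangentLeft I w.contMDiff).mdifferentiable (by simp) g
  have commutator := mvfderiv_mlieBracket (z.contMDiff g) minSmoothness_le_infty
    (field x) (field y)
  rw [mlieBracket_tangentLeftL_tangentLeftL I (mdifferentiableAt_coe I x g)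
    (mdifferentiableAt_coe I y g)] at commutator
  exact commutator

theorem rightBracketBilin_self (v : E) : rightBracketBilin I G v v = 0 :=
  congrFun mlieBracket_self (1 : G)

theorem rightBracket_jacobi (u v w : GroupLieAlgebra I G) :
    rightBracket I (rightBracket I u v) w + rightBracket I (rightBracket I v w) u +
      rightBracket I (rightBracket I w u) v = 0 := by
  have bracket_bracket (a b c : GroupLieAlgebra I G) :
      rightBracket I (rightBracket I a b) c = -⁅c, ⁅a, b⁆⁆ := by
    rw [rightBracket_eq_neg_lie, rightBracket_eq_neg_lie, neg_lie, neg_neg, lie_skew]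
  simp only [bracket_bracket]
  rw [← neg_add, ← neg_add, neg_eq_zero, ← add_rotate, lie_jacobi]

theorem leftConn_neg_bracket_left (x y z : Omega0 I G) :
    leftConn I (-bracket I x y) z =
      (leftConn I x (leftConn I y z) - leftConn I (leftConn I x y) z) -
        (leftConn I y (leftConn I x z) - leftConn I (leftConn I y x) z) := by
  have expand : leftConn I (leftConn I x y - leftConn I y x - bracket I x y) z =
      leftConn I (leftConn I x y) z - leftConn I (leftConn I y x) z +
        leftConn I (-bracket I x y) z := by
    ext g
    simp [leftConn_apply, sub_eq_add_neg]
  rw [leftConn_commutator] at expand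
  rw [eq_sub_of_add_eq' expand.symm]
  abel

theorem isPostLieAlgebra_leftConn :
    IsPostLieAlgebra ℝ (A := Omega0 I G) (fun x y => -bracket I x y) (leftConn I) where
  br_add_left _ _ _ := by ext; simp [bracket_apply, add_comm]
  br_smul_left _ _ _ := by ext; simp [bracket_apply]
  br_add_right _ _ _ := by ext; simp [bracket_apply, add_comm]
  br_smul_right _ _ _ := by ext; simp [bracket_apply]
  br_self _ := by ext; simp [bracket_apply, rightBracketBilin_self]
  br_jacobi x y z := by
    ext g
    simpa [bracket_apply] using! rightBracket_jacobi I (x g) (y g) (z g)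
  tr_add_left _ _ _ := by ext; simp [leftConn_apply]
  tr_smul_left _ _ _ := by ext; simp [leftConn_apply]
  tr_add_right _ y z := by
    ext g
    exact DFunLike.congr_fun
      (mvfderiv_add (mdifferentiableAt_coe I y g) (mdifferentiableAt_coe I z g)) _
  tr_smul_right c _ y := by
    ext g
    exact DFunLike.congr_fun (const_smul_mfderiv (mdifferentiableAt_coe I y g) c) _
  tr_br := leftConn_neg_bracket I
  br_tr := leftConn_neg_bracket_left I

end PostLie

end LieFun

theorem mainTheorem7_general {E : Type*} [NormedAddCommGroup E] [NormedSpace ℝ E]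
    [FiniteDimensional ℝ E] {H : Type*} [TopologicalSpace H] (I : ModelWithCorners ℝ E H)
    (G : Type*) [TopologicalSpace G] [ChartedSpace H G] [Group G] [LieGroup I ∞ G] :
    IsPostLieAlgebra ℝ (A := LieFun.Omega0 I G)
      (fun x y => -LieFun.bracket I x y) (LieFun.leftConn I) ∧
    (∀ x y : LieFun.Omega0 I G,
      LieFun.leftConn I x y =
        LieFun.rightToLeft I G (LieFun.rightConn I
          ((LieFun.rightToLeft I G).symm x) ((LieFun.rightToLeft I G).symm y)) +
        LieFun.bracket I x y) ∧
    (∀ v w : GroupLieAlgebra I G, LieFun.rightBracket I v w = -⁅v, w⁆) :=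
  ⟨LieFun.isPostLieAlgebra_leftConn I, LieFun.leftConn_eq_rightToLeft_rightConn_add_bracket I,
    LieFun.rightBracket_eq_neg_lie I⟩

theorem mainTheorem7 {E : Type*} [NormedAddCommGroup E] [NormedSpace ℝ E] [FiniteDimensional ℝ E]
    {H : Type*} [TopologicalSpace H] (I : ModelWithCorners ℝ E H) [I.Boundaryless]
    (G : Type*) [TopologicalSpace G] [ChartedSpace H G] [Group G] [LieGroup I ∞ G] :
    -- `{Ω⁰(G, 𝔤), -[·,·], ▷̃}` is a post-Lie algebra
    IsPostLieAlgebra ℝ (A := LieFun.Omega0 I G)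
      (fun x y => -LieFun.bracket I x y) (LieFun.leftConn I) ∧
    -- `x ▷̃ y = x ▷ y + [x,y]`, where `▷` is transported to the left trivialization
    (∀ x y : LieFun.Omega0 I G,
      LieFun.leftConn I x y =
        LieFun.rightToLeft I G (LieFun.rightConn I
          ((LieFun.rightToLeft I G).symm x) ((LieFun.rightToLeft I G).symm y)) +
        LieFun.bracket I x y) ∧
    -- the bracket of `𝔤` used here is the negative of the one from left-invariant vector fields
    (∀ v w : GroupLieAlgebra I G, LieFun.rightBracket I v w = -⁅v, w⁆) :=
  mainTheorem7_general I G
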